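/- Let $\mathcal A$ be a (not necessarily unital) $C^*$-algebra with multiplier algebra $M(\mathcal A)$, let $\mathcal C\subseteq\mathcal A$ be a separable abelian $C^*$-subalgebra, and let $\varphi$ be a positive functional on $\mathcal A$ such that $\mathcal C$ is contained in the centralizer $\mathcal A^\varphi=\{y\in\mathcal A : \varphi(xy)=\varphi(yx)\ \text{for all } x\in\mathcal A\}$. Identify $\mathcal C$ with $C_0(S)$ for a locally compact metric space $S$, and let $\mu_\varphi$ be the finite Radon measure on $S$ with $\varphi(y)=\int_S y(s)\,d\mu_\varphi(s)$ for $y\in\mathcal C=C_0(S)$. Then for every $x\in M(\mathcal A)$ there is a unique element $\Phi(x)\in L^\infty(S,\mu_\varphi)$ such that $$\int_S z(s)\,\Phi(x)(s)\,d\mu_\varphi(s)=\varphi(zx)\qquad\text{for all } z\in\mathcal C ,$$ which defines the conditional expectation $\Phi\colon M(\mathcal A)\to L^\infty(S,\mu_\varphi)$. Moreover, let $f\colon\underline I\to\mathbf R$ be a continuous concave function on a cube $\underline I=I_1\times\cdots\times I_n$, where each $I_i\subseteq\mathbf R$ is an interval, and let $\underline x=(x_1,\dots,x_n)$ be a tuple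 of mutually commuting self-adjoint elements of $\mathcal A$ with $\sigma(x_i)\subseteq I_i$ for each $i$. The spectrum is taken in $M(\mathcal A)$: this is the spectrum in $\mathcal A$ if $\mathcal A$ is unital, and in the unitization of $\mathcal A$ otherwise. Let $f(\underline x)\in M(\mathcal A)$ be given by the continuous functional calculus for commuting self-adjoint elements. Then for $\mu_\varphi$-almost every $s\in S$ the numbers $\Phi(x_i)(s)$ are real and belong to $I_i$ for $i=1,\dots,n$, the number $\Phi(f(\underline x))(s)$ is real, and $$\Phi(f(\underline x))(s)\le f\bigl(\Phi(x_1)(s),\dots,\Phi(x_n)(s)\bigr).$$ -/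

import Mathlib

open MeasureTheory WeakDual
open scoped MultiplierAlgebra ZeroAtInfty CompactlySupported ENNReal ComplexOrder

/-- The centralizer `A^φ = {y | φ (x * y) = φ (y * x) for all x}` of a functional `φ` on `A`. -/
def functionalCentralizer {A : Type*} [NonUnitalCStarAlgebra A] [PartialOrder A]
    [StarOrderedRing A] (φ : A →ₚ[ℂ] ℂ) : Set A :=
  {y | ∀ x : A, φ (x * y) = φ (y * x)}

noncomputable section JointCalculus

variable {B : Type*} [CStarAlgebra B] {n : ℕ}

/-- The unital C⋆-subalgebra generated by the entries of a tuple. -/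
def tupleAlgebra (x : Fin n → B) : StarSubalgebra ℂ B :=
  (StarAlgebra.adjoin ℂ (Set.range x)).topologicalClosure

theorem isClosed_tupleAlgebra (x : Fin n → B) : IsClosed (tupleAlgebra x : Set B) :=
  StarSubalgebra.isClosed_topologicalClosure _

theorem mem_tupleAlgebra (x : Fin n → B) (i : Fin n) : x i ∈ tupleAlgebra x :=
  StarSubalgebra.le_topologicalClosure _ (StarAlgebra.subset_adjoin ℂ _ ⟨i, rfl⟩)

/-- The C⋆-algebra generated by an abelian tuple of self-adjoint elements is commutative. -/
abbrev tupleAlgebraCommCStarAlgebra (x : Fin n → B) (hsa : ∀ i, IsSelfAdjoint (x i))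
    (hcomm : ∀ i j, Commute (x i) (x j)) : CommCStarAlgebra (tupleAlgebra x) :=
  { StarSubalgebra.cstarAlgebra (tupleAlgebra x) (h_closed := isClosed_tupleAlgebra x) with
    mul_comm := by
      have h := StarAlgebra.isMulCommutative_adjoin ℂ (s := Set.range x)
        (by rintro _ ⟨i, rfl⟩ _ ⟨j, rfl⟩; exact hcomm i j)
        (by rintro _ ⟨i, rfl⟩ _ ⟨j, rfl⟩; rw [(hsa j).star_eq]; exact hcomm i j)
      let inst := StarSubalgebra.commRingTopologicalClosure (StarAlgebra.adjoin ℂ (Set.range x))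
        (fun a b => h.is_comm.comm a b)
      exact inst.mul_comm }

/-- A character of the C⋆-algebra generated by the tuple sends each entry into the real spectrum of
that entry. -/
theorem character_re_mem_spectrum (x : Fin n → B) (hsa : ∀ i, IsSelfAdjoint (x i))
    (χ : characterSpace ℂ (tupleAlgebra x)) (i : Fin n) :
    (χ ⟨x i, mem_tupleAlgebra x i⟩).re ∈ spectrum ℝ (x i) := by
  have h1 : χ ⟨x i, mem_tupleAlgebra x i⟩ ∈
      spectrum ℂ (⟨x i, mem_tupleAlgebra x i⟩ : tupleAlgebra x) :=
    AlgHom.apply_mem_spectrum χ _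
  have h2 : χ ⟨x i, mem_tupleAlgebra x i⟩ ∈ spectrum ℂ (x i) := by
    rwa [StarSubalgebra.spectrum_eq (hS := isClosed_tupleAlgebra x)] at h1
  have h3 := (hsa i).mem_spectrum_eq_re h2
  rw [h3] at h2
  exact (spectrum.algebraMap_mem_iff ℂ).mp h2

/-- The element `f(x₁, …, xₙ)` of a unital C⋆-algebra, for an abelian tuple of self-adjoint elements
and a real function `f` continuous on the product of the spectra: the element of the commutative
C⋆-algebra generated by the tuple whose Gelfand transform is `χ ↦ f (χ x₁, …, χ xₙ)`. -/
def jointCalculus (f : (Fin n → ℝ) → ℝ) (x : Fin n → B) (hsa : ∀ i, IsSelfAdjoint (x i))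
    (hcomm : ∀ i j, Commute (x i) (x j))
    (hf : ContinuousOn f (Set.univ.pi fun i => spectrum ℝ (x i))) : B :=
  letI := tupleAlgebraCommCStarAlgebra x hsa hcomm
  ((gelfandStarTransform (tupleAlgebra x)).symm
    { toFun := fun χ => ((f fun i => (χ ⟨x i, mem_tupleAlgebra x i⟩).re : ℝ) : ℂ)
      continuous_toFun := by
        refine Complex.continuous_ofReal.comp (hf.comp_continuous ?_ ?_)
        · refine continuous_pi fun i => Complex.continuous_re.comp ?_
          exact map_continuous (gelfandTransform ℂ (tupleAlgebra x) ⟨x i, mem_tupleAlgebra x i⟩)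
        · intro χ i _
          exact character_re_mem_spectrum x hsa χ i } : tupleAlgebra x)

end JointCalculus

noncomputable section ConditionalExpectation

variable {A : Type*} [NonUnitalCStarAlgebra A] [PartialOrder A] [StarOrderedRing A]
  {C : NonUnitalStarSubalgebra ℂ A}
  {S : Type*} [TopologicalSpace S]

/-- A compactly supported real function seen as a complex function vanishing at infinity. -/
def compactToZeroAtInfty (g : C_c(S, ℝ)) : C₀(S, ℂ) where
  toFun s := (g s : ℂ)
  continuous_toFun := Complex.continuous_ofReal.comp (map_continuous g)
  zero_at_infty' := by
    have h := (zero_at_infty g)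
    simpa [Function.comp_def] using (Complex.continuous_ofReal.tendsto 0).comp h

/-- The positive functional `g ↦ φ(g)` on `C_c(S, ℝ)`, under the identification `e` of `C` with
`C₀(S)`. -/
def restrictedFunctional (φ : A →ₚ[ℂ] ℂ) (e : C ≃⋆ₐ[ℂ] C₀(S, ℂ)) : C_c(S, ℝ) →ₚ[ℝ] ℝ :=
  PositiveLinearMap.mk₀
    { toFun := fun g => (φ (e.symm (compactToZeroAtInfty g) : C)).re
      map_add' := by
        intro g h
        have : compactToZeroAtInfty (g + h) = compactToZeroAtInfty g + compactToZeroAtInfty h := by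
          ext s; simp [compactToZeroAtInfty]
        rw [this, map_add]; simp
      map_smul' := by
        intro r g
        have : compactToZeroAtInfty (r • g) = (r : ℂ) • compactToZeroAtInfty g := by
          ext s; simp [compactToZeroAtInfty]
        rw [this, map_smul]; simp }
    (by
      intro g hg
      have hg' : ∀ s, 0 ≤ g s := fun s => hg s
      let k : C₀(S, ℂ) :=
        { toFun := fun s => (Real.sqrt (g s) : ℂ)
          continuous_toFun :=
            Complex.continuous_ofReal.comp (Real.continuous_sqrt.comp (map_continuous g))
          zero_at_infty' := by
            have h := zero_at_infty g
            simpa [Function.comp_def] using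
              ((Complex.continuous_ofReal.comp Real.continuous_sqrt).tendsto 0).comp h }
      have hk : compactToZeroAtInfty g = star k * k := by
        ext s
        simp [compactToZeroAtInfty, k, ← Complex.ofReal_mul, Real.mul_self_sqrt (hg' s)]
      have : (0 : A) ≤ (e.symm (compactToZeroAtInfty g) : C) := by
        rw [hk, map_mul, map_star]
        exact star_mul_self_nonneg _
      exact (Complex.le_def.1 (map_nonneg φ this)).1)

variable [T2Space S] [LocallyCompactSpace S] [MeasurableSpace S] [BorelSpace S]

/-- The Radon measure `μ_φ` on `S` that the Riesz representation theorem associates with the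
restriction of `φ` to `C = C₀(S)`. -/
def functionalMeasure (φ : A →ₚ[ℂ] ℂ) (e : C ≃⋆ₐ[ℂ] C₀(S, ℂ)) : Measure S :=
  RealRMK.rieszMeasure (restrictedFunctional φ e)

/-- `g ∈ L^∞(S, μ_φ)` represents the functional `z ↦ φ(zx)` on `C = C₀(S)`:
`∫ z(s) g(s) dμ_φ(s) = φ(zx)` for all `z ∈ C`. Here `x.snd z` is the product `zx` of `z` with the
multiplier `x`. -/
def RepresentsMultiplier (φ : A →ₚ[ℂ] ℂ) (e : C ≃⋆ₐ[ℂ] C₀(S, ℂ)) (x : 𝓜(ℂ, A))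
    (g : Lp ℂ ∞ (functionalMeasure φ e)) : Prop :=
  ∀ z : C, ∫ s, e z s * g s ∂(functionalMeasure φ e) = φ (x.snd (z : A))

open Classical in
/-- The conditional expectation `Φ : M(A) → L^∞(S, μ_φ)`: `Φ(x)` is the element of `L^∞(S, μ_φ)`
with `∫ z(s) Φ(x)(s) dμ_φ(s) = φ(zx)` for all `z ∈ C`. -/
def conditionalExpectation (φ : A →ₚ[ℂ] ℂ) (e : C ≃⋆ₐ[ℂ] C₀(S, ℂ)) (x : 𝓜(ℂ, A)) :
    Lp ℂ ∞ (functionalMeasure φ e) :=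
  if h : ∃ g, RepresentsMultiplier φ e x g then h.choose else 0

end ConditionalExpectation

/-- A self-adjoint element of `A` is self-adjoint in the multiplier algebra. -/
theorem multiplier_isSelfAdjoint {A : Type*} [NonUnitalCStarAlgebra A] {n : ℕ} {x : Fin n → A}
    (hsa : ∀ i, IsSelfAdjoint (x i)) (i : Fin n) : IsSelfAdjoint (x i : 𝓜(ℂ, A)) :=
  (hsa i).map (DoubleCentralizer.coeHom (𝕜 := ℂ) (A := A))

/-- Commuting elements of `A` commute in the multiplier algebra. -/
theorem multiplier_commute {A : Type*} [NonUnitalCStarAlgebra A] {n : ℕ} {x : Fin n → A}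
    (hcomm : ∀ i j, Commute (x i) (x j)) (i j : Fin n) :
    Commute (x i : 𝓜(ℂ, A)) (x j : 𝓜(ℂ, A)) :=
  (hcomm i j).map (DoubleCentralizer.coeHom (𝕜 := ℂ) (A := A))

/-! A multiplier `X` has a density because `z ↦ φ(zX)` is bounded for the `L¹`-norm. Factor `z = vw`
with `v = z/√|z|` and `w = √|z|`. As `v` lies in the centralizer, `φ(vwX) = φ(wXv)`, and
Cauchy-Schwarz together with `X*X ≤ ‖X‖²` gives `|φ(zX)| ≤ ‖X‖ φ(|z|) = ‖X‖ ∫|z| dμ_φ`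
(`norm_apply_multiplier_snd_le`). Duality then yields a density bounded by `‖X‖`, unique since
`C₀(S)` is dense in `L²`. So `Φ` is linear, unital and contractive.

Such a map is positive on the commutative algebra generated by the tuple: the values of `Φ(y)` stay
in every disk containing all `χ(y)`, and countably many disks cut out the half-line `[0, ∞)`
(`ae_conditionalExpectation_nonneg`). Hence every affine inequality between `f` and the coordinates
on the joint spectrum passes to `Φ` almost everywhere.

Jensen's inequality follows on a compact box, where `-f` is a supremum of countably many affine
functions: the exceptional null sets are countable in number (`ae_jensen_of_Icc`). The spectra span
such a box inside the cube. -/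

/-! ### Density of `C₀` in `L^p`, and functionals bounded for the `L¹`-norm. -/

section ZeroAtInftyLp

variable {S : Type*} [TopologicalSpace S] [MeasurableSpace S] [BorelSpace S]

/-- The inclusion of `C₀(S, ℂ)` in `L^p(S, μ)` for a finite measure `μ`. -/
noncomputable def zeroAtInftyToLp (p : ℝ≥0∞) [Fact (1 ≤ p)] (μ : Measure S) [IsFiniteMeasure μ] :
    C₀(S, ℂ) →ₗ[ℂ] Lp ℂ p μ where
  toFun z := BoundedContinuousFunction.toLp p μ ℂ z.toBCF
  map_add' z w := map_add (BoundedContinuousFunction.toLp p μ ℂ) z.toBCF w.toBCF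
  map_smul' c z := map_smul (BoundedContinuousFunction.toLp p μ ℂ) c z.toBCF

theorem coeFn_zeroAtInftyToLp (p : ℝ≥0∞) [Fact (1 ≤ p)] (μ : Measure S) [IsFiniteMeasure μ]
    (z : C₀(S, ℂ)) : zeroAtInftyToLp p μ z =ᵐ[μ] z :=
  BoundedContinuousFunction.coeFn_toLp p μ ℂ z.toBCF

theorem integrable_zeroAtInfty (μ : Measure S) [IsFiniteMeasure μ] (z : C₀(S, ℂ)) :
    Integrable z μ :=
  z.toBCF.integrable μ

theorem integrable_zeroAtInfty_mul (μ : Measure S) [IsFiniteMeasure μ] (z : C₀(S, ℂ))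
    (g : Lp ℂ ∞ μ) : Integrable (fun s => z s * g s) μ :=
  (integrable_zeroAtInfty μ z).mul_of_top_left (Lp.memLp g)

theorem norm_zeroAtInftyToLp_one (μ : Measure S) [IsFiniteMeasure μ] (z : C₀(S, ℂ)) :
    ‖zeroAtInftyToLp 1 μ z‖ = ∫ s, ‖z s‖ ∂μ := by
  rw [L1.norm_eq_integral_norm]
  refine integral_congr_ae ?_
  filter_upwards [coeFn_zeroAtInftyToLp 1 μ z] with s hs
  rw [hs]

/-- A square integrable function `G` with `|∫ G̅ f| ≤ M ∫ |f|` for all square integrable `f` is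
bounded by `M`. -/
theorem ae_norm_le_of_norm_inner_le {α : Type*} [MeasurableSpace α] {μ : Measure α} [IsFiniteMeasure μ] (G : Lp ℂ 2 μ) {M : ℝ}
    (hM : 0 ≤ M) (h : ∀ f : Lp ℂ 2 μ, ‖inner ℂ G f‖ ≤ M * ∫ s, ‖f s‖ ∂μ) :
    ∀ᵐ s ∂μ, ‖G s‖ ≤ M := by
  have hG1 : Integrable (fun s => ‖G s‖) μ :=
    ((Lp.memLp G).integrable one_le_two).norm
  have hG2 : Integrable (fun s => ‖G s‖ ^ 2) μ :=
    (memLp_two_iff_integrable_sq_norm (Lp.aestronglyMeasurable G)).1 (Lp.memLp G)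
  have key : 0 ≤ᵐ[μ] fun s => M * ‖G s‖ - ‖G s‖ ^ 2 := by
    refine ae_nonneg_of_forall_setIntegral_nonneg ((hG1.const_mul M).sub hG2) fun A hA _ => ?_
    -- Testing with `f = 1_A G` gives `∫_A |G|² ≤ M ∫_A |G|` for every measurable `A`.
    have hmem : MemLp (A.indicator G) 2 μ := (Lp.memLp G).indicator hA
    have h1 := h hmem.toLp
    have e1 : inner ℂ G hmem.toLp = ((∫ s in A, ‖G s‖ ^ 2 ∂μ : ℝ) : ℂ) := by
      rw [L2.inner_def, ← integral_complex_ofReal, ← integral_indicator hA]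
      refine integral_congr_ae ?_
      filter_upwards [hmem.coeFn_toLp] with s hs
      rw [hs]
      by_cases hsA : s ∈ A
      · simp [hsA]
      · simp [hsA]
    have e2 : ∫ s, ‖(hmem.toLp _ : Lp ℂ 2 μ) s‖ ∂μ = ∫ s in A, ‖G s‖ ∂μ := by
      rw [← integral_indicator hA]
      refine integral_congr_ae ?_
      filter_upwards [hmem.coeFn_toLp] with s hs
      rw [hs, norm_indicator_eq_indicator_norm]
    rw [e1, e2, Complex.norm_real] at h1
    rw [integral_sub (hG1.const_mul M).integrableOn hG2.integrableOn, integral_const_mul]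
    linarith [le_abs_self (∫ s in A, ‖G s‖ ^ 2 ∂μ), Real.norm_eq_abs (∫ s in A, ‖G s‖ ^ 2 ∂μ)]
  filter_upwards [key] with s hs
  simp only [Pi.zero_apply] at hs
  by_contra! hlt
  nlinarith

variable [LocallyCompactSpace S] [TopologicalSpace.MetrizableSpace S]

theorem denseRange_zeroAtInftyToLp {p : ℝ≥0∞} [Fact (1 ≤ p)] (hp : p ≠ ∞) (μ : Measure S)
    [IsFiniteMeasure μ] [μ.Regular] : DenseRange (zeroAtInftyToLp p μ) := by
  intro f
  refine (mem_closure_iff_nhds_basis Metric.nhds_basis_closedEBall).2 fun ε hε ↦ ?_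
  obtain ⟨g, hgc, hg, hcont, -⟩ :=
    (Lp.memLp f).exists_hasCompactSupport_eLpNorm_sub_le hp hε.ne'
  refine ⟨_, ⟨⟨⟨g, hcont⟩, hgc.is_zero_at_infty⟩, rfl⟩, ?_⟩
  rw [Metric.mem_closedEBall, edist_comm, Lp.edist_def]
  refine le_trans (le_of_eq (eLpNorm_congr_ae ?_)) hg
  filter_upwards [coeFn_zeroAtInftyToLp p μ ⟨⟨g, hcont⟩, hgc.is_zero_at_infty⟩] with s hs
  simp only [Pi.sub_apply, hs]
  rfl

/-- An essentially bounded function is determined by its integrals against `C₀(S, ℂ)`. -/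
theorem Lp_top_ext_of_integral_zeroAtInfty {μ : Measure S} [IsFiniteMeasure μ] [μ.Regular]
    {g h : Lp ℂ ∞ μ} (H : ∀ z : C₀(S, ℂ), ∫ s, z s * g s ∂μ = ∫ s, z s * h s ∂μ) : g = h := by
  have hmem : MemLp (⇑(g - h)) 2 μ := (Lp.memLp (g - h)).mono_exponent le_top
  have key : hmem.toLp = 0 := by
    refine (denseRange_zeroAtInftyToLp (p := 2) (by simp) μ).eq_zero_of_inner_right ℂ ?_
    intro z
    rw [L2.inner_def]
    -- The inner product conjugates its first entry, so `star z` is the test function.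
    have h0 := H (star z)
    have := integral_sub (integrable_zeroAtInfty_mul μ (star z) g)
      (integrable_zeroAtInfty_mul μ (star z) h)
    rw [h0, sub_self] at this
    rw [← this]
    refine integral_congr_ae ?_
    filter_upwards [coeFn_zeroAtInftyToLp 2 μ z, hmem.coeFn_toLp, Lp.coeFn_sub g h]
      with s hs hs' hs''
    rw [hs, hs', hs'']
    simp [mul_comm, sub_mul]
  rw [← sub_eq_zero]
  refine Lp.ext ?_
  filter_upwards [hmem.coeFn_toLp, Lp.coeFn_zero ℂ ∞ μ, Lp.coeFn_zero ℂ 2 μ] with s h1 h2 h3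
  rw [← h1, key, h3, h2]

/-- A functional on `C₀(S, ℂ)` that is bounded for the `L¹`-norm is represented by an essentially
bounded function. -/
theorem exists_Lp_top_of_norm_le_integral_norm {μ : Measure S} [IsFiniteMeasure μ] [μ.Regular]
    (Λ : C₀(S, ℂ) →ₗ[ℂ] ℂ) {M : ℝ} (hM : 0 ≤ M) (hΛ : ∀ z, ‖Λ z‖ ≤ M * ∫ s, ‖z s‖ ∂μ) :
    ∃ g : Lp ℂ ∞ μ, (∀ᵐ s ∂μ, ‖g s‖ ≤ M) ∧ ∀ z : C₀(S, ℂ), ∫ s, z s * g s ∂μ = Λ z := by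
  have hd := denseRange_zeroAtInftyToLp (p := 1) (by simp) μ
  have hb : ∀ z, ‖Λ z‖ ≤ M * ‖zeroAtInftyToLp 1 μ z‖ := fun z => by
    rw [norm_zeroAtInftyToLp_one]; exact hΛ z
  let E : Lp ℂ 1 μ →L[ℂ] ℂ := Λ.extendOfNorm (zeroAtInftyToLp 1 μ)
  have hE : ∀ z, E (zeroAtInftyToLp 1 μ z) = Λ z := LinearMap.extendOfNorm_eq hd ⟨M, hb⟩
  have hE' : ∀ f, ‖E f‖ ≤ M * ‖f‖ := LinearMap.norm_extendOfNorm_apply_le hd M hb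
  -- The inclusion of `L²` in `L¹`, as Hölder multiplication by the constant 1; it lets the Riesz
  -- theorem in `L²` produce the density.
  let ι : Lp ℂ 2 μ →L[ℂ] Lp ℂ 1 μ :=
    (ContinuousLinearMap.mul ℂ ℂ).holderL μ 2 2 1 (indicatorConstLp 2 MeasurableSet.univ
      (measure_ne_top μ Set.univ) (1 : ℂ))
  have hι : ∀ f, ι f =ᵐ[μ] f := fun f => by
    filter_upwards [(ContinuousLinearMap.mul ℂ ℂ).coeFn_holder (r := 1) (indicatorConstLp 2
      MeasurableSet.univ (measure_ne_top μ Set.univ) (1 : ℂ)) f,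
      indicatorConstLp_coeFn (p := 2) (hs := MeasurableSet.univ)
        (hμs := measure_ne_top μ Set.univ) (c := (1 : ℂ))] with s hs hs'
    simp only [ι, ContinuousLinearMap.holderL_apply_apply]
    rw [hs, hs']
    simp
  obtain ⟨G, hG⟩ := (InnerProductSpace.toDual ℂ (Lp ℂ 2 μ)).surjective (E ∘L ι)
  have hG' : ∀ f, inner ℂ G f = E (ι f) := fun f => by
    rw [← InnerProductSpace.toDual_apply_apply, hG]; rfl
  have hGM : ∀ᵐ s ∂μ, ‖G s‖ ≤ M := by
    refine ae_norm_le_of_norm_inner_le G hM fun f => ?_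
    rw [hG']
    refine (hE' _).trans (le_of_eq ?_)
    rw [L1.norm_eq_integral_norm]
    congr 1
    refine integral_congr_ae ?_
    filter_upwards [hι f] with s hs
    rw [hs]
  have hmem : MemLp (fun s => star (G s)) ∞ μ :=
    memLp_top_of_bound (Lp.aestronglyMeasurable G).star M (by simpa using hGM)
  refine ⟨hmem.toLp, ?_, fun z => ?_⟩
  · filter_upwards [hmem.coeFn_toLp, hGM] with s hs hs'
    rw [hs, norm_star]; exact hs'
  · have : ι (zeroAtInftyToLp 2 μ z) = zeroAtInftyToLp 1 μ z := by
      refine Lp.ext ?_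
      filter_upwards [hι (zeroAtInftyToLp 2 μ z), coeFn_zeroAtInftyToLp 2 μ z,
        coeFn_zeroAtInftyToLp 1 μ z] with s h1 h2 h3
      rw [h1, h2, h3]
    rw [← hE, ← this, ← hG', L2.inner_def]
    refine integral_congr_ae ?_
    filter_upwards [hmem.coeFn_toLp, coeFn_zeroAtInftyToLp 2 μ z] with s h1 h2
    rw [h1, h2]
    simp

end ZeroAtInftyLp

/-! ### Cauchy-Schwarz for multipliers. -/

section Multipliers

variable {A : Type*} [NonUnitalCStarAlgebra A]

/-- The difference `d` of the two sides satisfies `dc = 0` for all `c`; taking `c = d*` forces `d =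
0`. -/
theorem multiplier_snd_mul (X : 𝓜(ℂ, A)) (a b : A) : X.snd (a * b) = a * X.snd b := by
  have h : ∀ c, (X.snd (a * b) - a * X.snd b) * c = 0 := fun c => by
    rw [sub_mul, X.central, mul_assoc, mul_assoc, X.central, sub_self]
  have := h (star (X.snd (a * b) - a * X.snd b))
  rwa [CStarRing.mul_star_self_eq_zero_iff, sub_eq_zero] at this

theorem star_multiplier_fst_mul_self (Y : 𝓜(ℂ, A)) (v : A) :
    star (Y.fst v) * Y.fst v = star v * (star Y * Y).fst v := by
  have h : star (Y.fst v) = (star Y).snd (star v) := by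
    rw [DoubleCentralizer.star_snd, star_star]
  rw [h, (star Y).central, DoubleCentralizer.mul_fst]
  rfl

variable [PartialOrder A] [StarOrderedRing A]

/-- In the multiplier algebra `‖X‖² - X*X = Y*Y`, and compressing by `v` gives the positive element
`(Yv)*(Yv)` of `A`. -/
theorem star_multiplier_fst_mul_self_le (X : 𝓜(ℂ, A)) (v : A) :
    star (X.fst v) * X.fst v ≤ ((‖X‖ ^ 2 : ℝ) : ℂ) • (star v * v) := by
  obtain ⟨Y, hY⟩ : ∃ Y : 𝓜(ℂ, A),
      algebraMap ℂ 𝓜(ℂ, A) ((‖X‖ ^ 2 : ℝ) : ℂ) - star X * X = star Y * Y := by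
    let _ := CStarAlgebra.spectralOrder 𝓜(ℂ, A)
    let _ := CStarAlgebra.spectralOrderedRing 𝓜(ℂ, A)
    have h := CStarAlgebra.star_mul_le_algebraMap_norm_sq (a := X)
    obtain ⟨Y, hY⟩ := CStarAlgebra.nonneg_iff_eq_star_mul_self.1 (sub_nonneg.2 h)
    exact ⟨Y, by rw [← hY]; rfl⟩
  rw [← sub_nonneg]
  convert star_mul_self_nonneg (Y.fst v)
  rw [star_multiplier_fst_mul_self, star_multiplier_fst_mul_self, ← hY,
    DoubleCentralizer.sub_fst, DoubleCentralizer.algebraMap_fst, sub_apply,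
    mul_sub, Algebra.algebraMap_eq_smul_one, smul_apply,
    one_apply_eq_self, mul_smul_comm]

theorem PositiveLinearMap.norm_apply_star_mul_le (φ : A →ₚ[ℂ] ℂ) (a b : A) :
    ‖φ (star a * b)‖ ≤ √(φ (star a * a)).re * √(φ (star b * b)).re :=
  norm_inner_le_norm (𝕜 := ℂ) (φ.toPreGNS a) (φ.toPreGNS b)

/-- If `v` lies in the centralizer of `φ`, the functional `X ↦ φ(vwX)` on the multiplier algebra
satisfies a Cauchy-Schwarz inequality. -/
theorem norm_apply_multiplier_snd_mul_le (φ : A →ₚ[ℂ] ℂ) (X : 𝓜(ℂ, A)) {v w : A}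
    (hv : v ∈ functionalCentralizer φ) :
    ‖φ (X.snd (v * w))‖ ≤ ‖X‖ * (√(φ (w * star w)).re * √(φ (star v * v)).re) := by
  have h1 : φ (X.snd (v * w)) = φ (star (star w) * X.fst v) := by
    rw [multiplier_snd_mul, ← hv, X.central, star_star]
  have h2 := (Complex.le_def.1 (OrderHomClass.mono φ (star_multiplier_fst_mul_self_le X v))).1
  rw [map_smul, smul_eq_mul, Complex.re_ofReal_mul] at h2
  rw [h1]
  refine (φ.norm_apply_star_mul_le _ _).trans ?_
  rw [star_star]
  have h3 := Real.sqrt_le_sqrt h2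
  rw [Real.sqrt_mul (by positivity), Real.sqrt_sq (norm_nonneg X)] at h3
  calc _ ≤ √(φ (w * star w)).re * (‖X‖ * √(φ (star v * v)).re) := by gcongr
    _ = _ := by ring

end Multipliers

/-! ### Functions for the factorization `z = (z/√|z|) √|z|`. -/

section AbsSqrt

/-- The modulus is `√|z|`, which tends to 0 at the origin, where the convention `0/0 = 0` gives the
right value. -/
theorem Complex.continuous_div_sqrt_norm : Continuous fun z : ℂ => z / (√‖z‖ : ℂ) := by
  rw [continuous_iff_continuousAt]
  intro z
  by_cases hz : z = 0
  · subst hz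
    have h : ∀ z : ℂ, ‖z / (√‖z‖ : ℂ)‖ = √‖z‖ := fun z => by
      rw [norm_div, Complex.norm_real, Real.norm_of_nonneg (Real.sqrt_nonneg _), Real.div_sqrt]
    rw [ContinuousAt, zero_div, tendsto_zero_iff_norm_tendsto_zero]
    simp_rw [h]
    exact (Real.continuous_sqrt.comp continuous_norm).tendsto' 0 0 (by simp)
  · refine ContinuousAt.div continuousAt_id (by fun_prop) ?_
    simpa using hz

variable {S : Type*} [TopologicalSpace S]

/-- The composition of `z ∈ C₀(S, ℂ)` with a continuous map that fixes the origin. -/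
noncomputable def zeroAtInftyComp (z : C₀(S, ℂ)) (q : ℂ → ℂ) (hq : Continuous q) (h0 : q 0 = 0) : C₀(S, ℂ) where
  toFun s := q (z s)
  continuous_toFun := hq.comp (map_continuous z)
  zero_at_infty' := (hq.tendsto' 0 0 h0).comp (zero_at_infty z)

end AbsSqrt

/-! ### The measure `μ_φ`: finiteness and integration of `C₀(S)`. -/

section RestrictedFunctional

variable {A : Type*} [NonUnitalCStarAlgebra A] {C : NonUnitalStarSubalgebra ℂ A}
  {S : Type*} [TopologicalSpace S]

/-- A star homomorphism between C⋆-algebras is contractive. -/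
theorem norm_symm_apply_le (e : C ≃⋆ₐ[ℂ] C₀(S, ℂ)) (z : C₀(S, ℂ)) :
    ‖(e.symm z : A)‖ ≤ ‖z‖ := by
  let j : C₀(S, ℂ) →⋆ₙₐ[ℂ] A :=
    { toFun := fun z => (e.symm z : A)
      map_smul' := fun c z => by rw [map_smul]; rfl
      map_zero' := by rw [map_zero]; rfl
      map_add' := fun z w => by rw [map_add]; rfl
      map_mul' := fun z w => by rw [map_mul]; rfl
      map_star' := fun z => by rw [map_star]; rfl }
  exact NonUnitalStarAlgHom.norm_apply_le j z

variable [PartialOrder A] [StarOrderedRing A]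

/-- The functional `z ↦ φ(z)` on `C₀(S, ℂ)`, under the identification `e` of `C` with `C₀(S)`. -/
noncomputable def zeroAtInftyFunctional (φ : A →ₚ[ℂ] ℂ) (e : C ≃⋆ₐ[ℂ] C₀(S, ℂ)) :
    C₀(S, ℂ) →L[ℂ] ℂ :=
  LinearMap.mkContinuousOfExistsBound
    { toFun := fun z => φ (e.symm z)
      map_add' := fun z w => by simp
      map_smul' := fun c z => by simp }
    (by
      obtain ⟨K, hK⟩ := φ.exists_norm_apply_le
      exact ⟨K, fun z => (hK _).trans (by gcongr; exact norm_symm_apply_le e z)⟩)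

theorem zeroAtInftyFunctional_apply (φ : A →ₚ[ℂ] ℂ) (e : C ≃⋆ₐ[ℂ] C₀(S, ℂ)) (z : C₀(S, ℂ)) :
    zeroAtInftyFunctional φ e z = φ (e.symm z) :=
  rfl

theorem zeroAtInftyFunctional_compactToZeroAtInfty (φ : A →ₚ[ℂ] ℂ) (e : C ≃⋆ₐ[ℂ] C₀(S, ℂ))
    (g : C_c(S, ℝ)) :
    zeroAtInftyFunctional φ e (compactToZeroAtInfty g) = (restrictedFunctional φ e g : ℂ) := by
  have h : star (compactToZeroAtInfty g) = compactToZeroAtInfty g := by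
    ext s; simp [compactToZeroAtInfty]
  have h2 : (starRingEnd ℂ) (φ (e.symm (compactToZeroAtInfty g) : C)) =
      φ (e.symm (compactToZeroAtInfty g) : C) := by
    rw [← Complex.star_def, ← map_star φ]
    change φ ((star (e.symm (compactToZeroAtInfty g)) : C) : A) = _
    rw [← map_star, h]
  exact (Complex.conj_eq_iff_re.1 h2).symm

theorem norm_compactToZeroAtInfty_le (g : C_c(S, ℝ)) {K : ℝ} (hK : 0 ≤ K)
    (hg : ∀ s, |g s| ≤ K) : ‖compactToZeroAtInfty g‖ ≤ K := by
  rw [← ZeroAtInftyContinuousMap.norm_toBCF_eq_norm, BoundedContinuousFunction.norm_le hK]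
  intro s
  simpa [compactToZeroAtInfty] using hg s

variable [T2Space S] [LocallyCompactSpace S]

theorem exists_compactlySupported_eq_one {K : Set S} (hK : IsCompact K) :
    ∃ g : C_c(S, ℝ), (∀ s ∈ K, g s = 1) ∧ ∀ s, 0 ≤ g s ∧ g s ≤ 1 := by
  obtain ⟨f, h1, -, hc, h01⟩ :=
    exists_continuous_one_zero_of_isCompact hK isClosed_empty (Set.disjoint_empty K)
  exact ⟨⟨f, hc⟩, h1, h01⟩

/-- Every element of `C₀(S, ℂ)` is a limit of combinations `g + ih` with `g` and `h` real and
compactly supported. -/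
theorem exists_compactlySupported_norm_sub_le (z : C₀(S, ℂ)) {ε : ℝ} (hε : 0 < ε) :
    ∃ g h : C_c(S, ℝ),
      ‖z - (compactToZeroAtInfty g + Complex.I • compactToZeroAtInfty h)‖ ≤ ε := by
  obtain ⟨K, hK, hKz⟩ := Filter.mem_cocompact.1
    ((zero_at_infty z).eventually (Metric.ball_mem_nhds 0 hε))
  obtain ⟨b, hb1, hb⟩ := exists_compactlySupported_eq_one hK
  -- The cutoff `b` leaves the error `(1 - b)z`, which vanishes on `K` and is below `ε` off `K`.
  let g : C_c(S, ℝ) := ⟨⟨fun s => b s * (z s).re,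
    (map_continuous b).mul (Complex.continuous_re.comp (map_continuous z))⟩,
    b.hasCompactSupport.mul_right⟩
  let h : C_c(S, ℝ) := ⟨⟨fun s => b s * (z s).im,
    (map_continuous b).mul (Complex.continuous_im.comp (map_continuous z))⟩,
    b.hasCompactSupport.mul_right⟩
  refine ⟨g, h, ?_⟩
  rw [← ZeroAtInftyContinuousMap.norm_toBCF_eq_norm, BoundedContinuousFunction.norm_le hε.le]
  intro s
  have e1 : (z - (compactToZeroAtInfty g + Complex.I • compactToZeroAtInfty h)).toBCF s =
      ((1 - b s : ℝ) : ℂ) * z s := by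
    change z s - (((b s * (z s).re : ℝ) : ℂ) + Complex.I * ((b s * (z s).im : ℝ) : ℂ)) = _
    apply Complex.ext <;> simp <;> ring
  rw [e1, norm_mul, Complex.norm_real, Real.norm_eq_abs, abs_of_nonneg (by linarith [(hb s).2])]
  by_cases hs : s ∈ K
  · rw [hb1 s hs, sub_self, zero_mul]; exact hε.le
  · have : ‖z s‖ < ε := by simpa using hKz hs
    nlinarith [hb s, norm_nonneg (z s)]

variable [MeasurableSpace S] [BorelSpace S] (φ : A →ₚ[ℂ] ℂ) (e : C ≃⋆ₐ[ℂ] C₀(S, ℂ))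

instance regular_functionalMeasure : (functionalMeasure φ e).Regular :=
  RealRMK.regular_rieszMeasure _

instance isFiniteMeasure_functionalMeasure : IsFiniteMeasure (functionalMeasure φ e) where
  measure_univ_lt_top := by
    -- By inner regularity it suffices to bound compact sets, whose mass is at most `φ(g)` for a
    -- cutoff `g` of norm at most 1.
    rw [isOpen_univ.measure_eq_iSup_isCompact]
    refine lt_of_le_of_lt (iSup₂_le fun K _ => iSup_le fun hK => ?_)
      (ENNReal.ofReal_lt_top (r := ‖zeroAtInftyFunctional φ e‖))
    obtain ⟨g, hg1, hg⟩ := exists_compactlySupported_eq_one hK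
    refine (RealRMK.rieszMeasure_le_of_eq_one _ (fun s => (hg s).1) hK hg1).trans
      (ENNReal.ofReal_le_ofReal ?_)
    have h1 : ‖compactToZeroAtInfty g‖ ≤ 1 := norm_compactToZeroAtInfty_le g zero_le_one
      fun s => abs_le.2 ⟨by linarith [(hg s).1], (hg s).2⟩
    have h2 := (zeroAtInftyFunctional φ e).le_opNorm_of_le h1
    rw [zeroAtInftyFunctional_compactToZeroAtInfty, Complex.norm_real, mul_one] at h2
    exact (le_abs_self _).trans h2

theorem integral_compactToZeroAtInfty (g : C_c(S, ℝ)) :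
    ∫ s, compactToZeroAtInfty g s ∂(functionalMeasure φ e) =
      zeroAtInftyFunctional φ e (compactToZeroAtInfty g) := by
  rw [zeroAtInftyFunctional_compactToZeroAtInfty]
  rw [← RealRMK.integral_rieszMeasure (restrictedFunctional φ e) g, ← integral_complex_ofReal]
  rfl

/-- `φ(z) = ∫ z dμ_φ` for `z ∈ C = C₀(S)`. -/
theorem integral_functionalMeasure (z : C₀(S, ℂ)) :
    ∫ s, z s ∂(functionalMeasure φ e) = φ (e.symm z) := by
  set μ := functionalMeasure φ e with hμ
  rw [← zeroAtInftyFunctional_apply, ← sub_eq_zero, ← norm_le_zero_iff]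
  set L := ‖zeroAtInftyFunctional φ e‖ with hL
  refine le_of_forall_pos_le_add fun ε hε => ?_
  -- Both sides are continuous in the sup norm, with constants `μ(S)` and `L`; the extra 1 only
  -- keeps the divisor positive.
  have hpos : 0 < μ.real Set.univ + L + 1 := by positivity
  obtain ⟨g, h, hgh⟩ := exists_compactlySupported_norm_sub_le z (div_pos hε hpos)
  set w := compactToZeroAtInfty g + Complex.I • compactToZeroAtInfty h with hw
  have hwint : ∫ s, w s ∂μ = zeroAtInftyFunctional φ e w := by
    rw [hw, map_add, map_smul, ← integral_compactToZeroAtInfty, ← integral_compactToZeroAtInfty,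
      smul_eq_mul, ← integral_const_mul, ← integral_add]
    · rfl
    · exact (compactToZeroAtInfty g).toBCF.integrable μ
    · exact ((compactToZeroAtInfty h).toBCF.integrable μ).const_mul _
  have h1 : ‖∫ s, (z - w) s ∂μ‖ ≤ ε / (μ.real Set.univ + L + 1) * μ.real Set.univ := by
    refine norm_integral_le_of_norm_le_const (Filter.Eventually.of_forall fun s => ?_)
    exact ((z - w).toBCF.norm_coe_le_norm s).trans hgh
  have h2 := (zeroAtInftyFunctional φ e).le_opNorm_of_le hgh
  rw [← hL] at h2
  have h3 : ∫ s, (z - w) s ∂μ = ∫ s, z s ∂μ - ∫ s, w s ∂μ :=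
    integral_sub (z.toBCF.integrable μ) (w.toBCF.integrable μ)
  have h4 : ∫ s, z s ∂μ - zeroAtInftyFunctional φ e z =
      ∫ s, (z - w) s ∂μ - zeroAtInftyFunctional φ e (z - w) := by
    rw [h3, hwint, map_sub]; ring
  rw [h4, zero_add]
  refine (norm_sub_le _ _).trans ((add_le_add h1 h2).trans ?_)
  rw [mul_comm _ (ε / _), ← mul_add]
  calc _ ≤ ε / (μ.real Set.univ + L + 1) * (μ.real Set.univ + L + 1) := mul_le_mul_of_nonneg_left (by linarith) (by positivity)
    _ = ε := by field_simp

end RestrictedFunctional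

/-! ### Existence, linearity and contractivity of the conditional expectation. -/

section CondExp

variable {A : Type*} [NonUnitalCStarAlgebra A] [PartialOrder A] [StarOrderedRing A]
  {C : NonUnitalStarSubalgebra ℂ A} {S : Type*} [TopologicalSpace S] [LocallyCompactSpace S]

/-- `|φ(zX)| ≤ ‖X‖ φ(|z|)` for `z ∈ C` and a multiplier `X`, if `C` is contained in the
centralizer of `φ`. -/
theorem norm_apply_multiplier_snd_le [T2Space S] [MeasurableSpace S] [BorelSpace S]
    {φ : A →ₚ[ℂ] ℂ} (hCφ : (C : Set A) ⊆ functionalCentralizer φ)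
    (e : C ≃⋆ₐ[ℂ] C₀(S, ℂ)) (X : 𝓜(ℂ, A)) (z : C₀(S, ℂ)) :
    ‖φ (X.snd (e.symm z))‖ ≤ ‖X‖ * ∫ s, ‖z s‖ ∂(functionalMeasure φ e) := by
  let v := zeroAtInftyComp z _ Complex.continuous_div_sqrt_norm (by simp)
  let w := zeroAtInftyComp z (fun c => (√‖c‖ : ℂ)) (by fun_prop) (by simp)
  let a := zeroAtInftyComp z (fun c => (‖c‖ : ℂ)) (by fun_prop) (by simp)
  have hvw : v * w = z := by
    ext s
    change z s / (√‖z s‖ : ℂ) * (√‖z s‖ : ℂ) = z s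
    by_cases h : z s = 0
    · simp [h]
    · exact div_mul_cancel₀ _ (by simpa using h)
  have hww : w * star w = a := by
    ext s
    change (√‖z s‖ : ℂ) * star (√‖z s‖ : ℂ) = (‖z s‖ : ℂ)
    simp [← Complex.ofReal_mul]
  have hvv : star v * v = a := by
    ext s
    change star (z s / (√‖z s‖ : ℂ)) * (z s / (√‖z s‖ : ℂ)) = (‖z s‖ : ℂ)
    rw [Complex.star_def, Complex.conj_mul', norm_div, Complex.norm_real,
      Real.norm_of_nonneg (Real.sqrt_nonneg _), Real.div_sqrt, ← Complex.ofReal_pow,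
      Real.sq_sqrt (norm_nonneg _)]
  have ha : (φ (e.symm a : A)).re = ∫ s, ‖z s‖ ∂(functionalMeasure φ e) := by
    rw [← integral_functionalMeasure]
    change (∫ s, ((‖z s‖ : ℝ) : ℂ) ∂_).re = _
    rw [integral_complex_ofReal, Complex.ofReal_re]
  have h := norm_apply_multiplier_snd_mul_le φ X (v := (e.symm v : A)) (w := (e.symm w : A))
    (hCφ (e.symm v).2)
  have h1 : (e.symm v : A) * (e.symm w : A) = e.symm z := by
    rw [← hvw, map_mul]; rfl
  have h2 : (e.symm w : A) * star (e.symm w : A) = e.symm a := by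
    rw [← hww, map_mul, map_star]; rfl
  have h3 : star (e.symm v : A) * (e.symm v : A) = e.symm a := by
    rw [← hvv, map_mul, map_star]; rfl
  rw [h1, h2, h3, ha, Real.mul_self_sqrt (integral_nonneg fun s => norm_nonneg _)] at h
  exact h

variable [TopologicalSpace.MetrizableSpace S] [MeasurableSpace S] [BorelSpace S]
  {φ : A →ₚ[ℂ] ℂ}

theorem RepresentsMultiplier.unique {e : C ≃⋆ₐ[ℂ] C₀(S, ℂ)} {X : 𝓜(ℂ, A)}
    {g h : Lp ℂ ∞ (functionalMeasure φ e)} (hg : RepresentsMultiplier φ e X g)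
    (hh : RepresentsMultiplier φ e X h) : g = h := by
  refine Lp_top_ext_of_integral_zeroAtInfty fun z => ?_
  have h1 := hg (e.symm z)
  have h2 := hh (e.symm z)
  rw [StarAlgEquiv.apply_symm_apply] at h1 h2
  rw [h1, h2]

theorem exists_representsMultiplier (hCφ : (C : Set A) ⊆ functionalCentralizer φ)
    (e : C ≃⋆ₐ[ℂ] C₀(S, ℂ)) (X : 𝓜(ℂ, A)) :
    ∃ g, RepresentsMultiplier φ e X g ∧ ∀ᵐ s ∂(functionalMeasure φ e), ‖g s‖ ≤ ‖X‖ := by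
  let Λ : C₀(S, ℂ) →ₗ[ℂ] ℂ :=
    { toFun := fun z => φ (X.snd (e.symm z))
      map_add' := fun z w => by simp
      map_smul' := fun c z => by simp }
  obtain ⟨g, hg, hgΛ⟩ := exists_Lp_top_of_norm_le_integral_norm Λ (norm_nonneg X)
    (norm_apply_multiplier_snd_le hCφ e X)
  refine ⟨g, fun z => ?_, hg⟩
  rw [hgΛ]
  simp [Λ]

theorem representsMultiplier_conditionalExpectation
    (hCφ : (C : Set A) ⊆ functionalCentralizer φ) (e : C ≃⋆ₐ[ℂ] C₀(S, ℂ)) (X : 𝓜(ℂ, A)) :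
    RepresentsMultiplier φ e X (conditionalExpectation φ e X) := by
  have h : ∃ g, RepresentsMultiplier φ e X g :=
    (exists_representsMultiplier hCφ e X).imp fun _ h => h.1
  rw [conditionalExpectation, dif_pos h]
  exact h.choose_spec

theorem ae_norm_conditionalExpectation_le (hCφ : (C : Set A) ⊆ functionalCentralizer φ)
    (e : C ≃⋆ₐ[ℂ] C₀(S, ℂ)) (X : 𝓜(ℂ, A)) :
    ∀ᵐ s ∂(functionalMeasure φ e), ‖conditionalExpectation φ e X s‖ ≤ ‖X‖ := by
  obtain ⟨g, hg, hgX⟩ := exists_representsMultiplier hCφ e X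
  rwa [(representsMultiplier_conditionalExpectation hCφ e X).unique hg]

/-- The conditional expectation as a linear map. -/
noncomputable def conditionalExpectationₗ (hCφ : (C : Set A) ⊆ functionalCentralizer φ)
    (e : C ≃⋆ₐ[ℂ] C₀(S, ℂ)) : 𝓜(ℂ, A) →ₗ[ℂ] Lp ℂ ∞ (functionalMeasure φ e) where
  toFun := conditionalExpectation φ e
  map_add' X Y := by
    refine (representsMultiplier_conditionalExpectation hCφ e (X + Y)).unique fun z => ?_
    rw [DoubleCentralizer.add_snd, add_apply, map_add,
      ← representsMultiplier_conditionalExpectation hCφ e X z,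
      ← representsMultiplier_conditionalExpectation hCφ e Y z,
      ← integral_add (integrable_zeroAtInfty_mul _ _ _) (integrable_zeroAtInfty_mul _ _ _)]
    refine integral_congr_ae ?_
    filter_upwards [Lp.coeFn_add (conditionalExpectation φ e X) (conditionalExpectation φ e Y)]
      with s hs
    rw [hs, Pi.add_apply, mul_add]
  map_smul' c X := by
    refine (representsMultiplier_conditionalExpectation hCφ e (c • X)).unique fun z => ?_
    rw [DoubleCentralizer.smul_snd, smul_apply, map_smul,
      ← representsMultiplier_conditionalExpectation hCφ e X z, smul_eq_mul, ← integral_const_mul]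
    refine integral_congr_ae ?_
    filter_upwards [Lp.coeFn_smul c (conditionalExpectation φ e X)] with s hs
    rw [RingHom.id_apply, hs, Pi.smul_apply, smul_eq_mul]
    ring

theorem ae_conditionalExpectation_one (hCφ : (C : Set A) ⊆ functionalCentralizer φ)
    (e : C ≃⋆ₐ[ℂ] C₀(S, ℂ)) :
    ∀ᵐ s ∂(functionalMeasure φ e), conditionalExpectation φ e 1 s = 1 := by
  have hmem : MemLp (fun _ : S => (1 : ℂ)) ∞ (functionalMeasure φ e) := memLp_const 1
  have h : RepresentsMultiplier φ e 1 (hmem.toLp _) := fun z => by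
    rw [DoubleCentralizer.one_snd, one_apply_eq_self, ← e.symm_apply_apply z,
      ← integral_functionalMeasure, e.symm_apply_apply]
    refine integral_congr_ae ?_
    filter_upwards [hmem.coeFn_toLp] with s hs
    rw [hs, mul_one]
  rw [(representsMultiplier_conditionalExpectation hCφ e 1).unique h]
  exact hmem.coeFn_toLp

/-- Linearity of the conditional expectation, pointwise almost everywhere. -/
theorem ae_conditionalExpectation_combination (hCφ : (C : Set A) ⊆ functionalCentralizer φ)
    (e : C ≃⋆ₐ[ℂ] C₀(S, ℂ)) {ι : Type*} [Fintype ι] (l : ι → ℂ) (X : ι → 𝓜(ℂ, A)) :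
    ∀ᵐ s ∂(functionalMeasure φ e), conditionalExpectation φ e (∑ i, l i • X i) s =
      ∑ i, l i * conditionalExpectation φ e (X i) s := by
  have h : conditionalExpectation φ e (∑ i, l i • X i) =
      ∑ i, l i • conditionalExpectation φ e (X i) := by
    have := map_sum (conditionalExpectationₗ hCφ e) (fun i => l i • X i) Finset.univ
    simp_rw [map_smul] at this
    exact this
  rw [h]
  have h2 : ∀ᵐ s ∂(functionalMeasure φ e), ∀ i,
      (l i • conditionalExpectation φ e (X i)) s = l i * conditionalExpectation φ e (X i) s :=
    ae_all_iff.2 fun i => Lp.coeFn_smul _ _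
  filter_upwards [Lp.coeFn_finsetSum Finset.univ fun i => l i • conditionalExpectation φ e (X i),
    h2] with s hs hs2
  rw [hs, Finset.sum_apply]
  exact Finset.sum_congr rfl fun i _ => hs2 i

theorem ae_norm_conditionalExpectation_sub_le (hCφ : (C : Set A) ⊆ functionalCentralizer φ)
    (e : C ≃⋆ₐ[ℂ] C₀(S, ℂ)) (X : 𝓜(ℂ, A)) (c : ℂ) :
    ∀ᵐ s ∂(functionalMeasure φ e),
      ‖conditionalExpectation φ e X s - c‖ ≤ ‖X - algebraMap ℂ 𝓜(ℂ, A) c‖ := by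
  filter_upwards [ae_norm_conditionalExpectation_le hCφ e (X - algebraMap ℂ 𝓜(ℂ, A) c),
    ae_conditionalExpectation_combination hCφ e ![1, -c] ![X, 1],
    ae_conditionalExpectation_one hCφ e] with s h1 h2 h3
  have : X - algebraMap ℂ 𝓜(ℂ, A) c = ∑ i, ![1, -c] i • ![X, 1] i := by
    simp [Algebra.algebraMap_eq_smul_one, sub_eq_add_neg]
  rw [← this] at h2
  rw [h2] at h1
  simpa [h3, sub_eq_add_neg] using h1

end CondExp

/-! ### Characters of the algebra generated by the tuple. -/

section Characters

variable {B : Type*} [CStarAlgebra B] {n : ℕ} (x : Fin n → B)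

/-- The Gelfand transform of a commutative C⋆-algebra is isometric, so a disk containing all
character values bounds the norm. -/
theorem norm_sub_algebraMap_le_of_character (hsa : ∀ i, IsSelfAdjoint (x i))
    (hcomm : ∀ i j, Commute (x i) (x j)) (y : tupleAlgebra x) (c : ℂ) {K : ℝ} (hK : 0 ≤ K)
    (h : ∀ χ : characterSpace ℂ (tupleAlgebra x), ‖χ y - c‖ ≤ K) :
    ‖(y : B) - algebraMap ℂ B c‖ ≤ K := by
  let _ := tupleAlgebraCommCStarAlgebra x hsa hcomm
  have h1 : ‖gelfandTransform ℂ (tupleAlgebra x) (y - algebraMap ℂ (tupleAlgebra x) c)‖ =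
      ‖y - algebraMap ℂ (tupleAlgebra x) c‖ :=
    (gelfandTransform_isometry (tupleAlgebra x)).norm_map_of_map_zero (map_zero _) _
  have h2 : ‖(y : B) - algebraMap ℂ B c‖ = ‖y - algebraMap ℂ (tupleAlgebra x) c‖ := rfl
  rw [h2, ← h1, ContinuousMap.norm_le _ hK]
  intro χ
  have h3 : gelfandTransform ℂ (tupleAlgebra x) (y - algebraMap ℂ (tupleAlgebra x) c) χ =
      χ y - c := by
    rw [gelfandTransform_apply_apply, map_sub, AlgHomClass.commutes]
    rfl
  rw [h3]
  exact h χ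

theorem norm_character_apply_le (χ : characterSpace ℂ (tupleAlgebra x)) (y : tupleAlgebra x) :
    ‖χ y‖ ≤ ‖(y : B)‖ := by
  have : IsClosed (tupleAlgebra x : Set B) := isClosed_tupleAlgebra x
  let _ := StarSubalgebra.cstarAlgebra (tupleAlgebra x) (h_closed := isClosed_tupleAlgebra x)
  have h := spectrum.norm_le_norm_mul_of_mem (AlgHom.apply_mem_spectrum χ y)
  rcases subsingleton_or_nontrivial (tupleAlgebra x) with hs | hn
  · rw [Subsingleton.elim y 0, map_zero, norm_zero]; exact norm_nonneg _
  · rwa [CStarRing.norm_one, mul_one] at h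

theorem character_apply_eq_re (hsa : ∀ i, IsSelfAdjoint (x i))
    (χ : characterSpace ℂ (tupleAlgebra x)) (i : Fin n) :
    χ ⟨x i, mem_tupleAlgebra x i⟩ = ((χ ⟨x i, mem_tupleAlgebra x i⟩).re : ℂ) := by
  have h1 : χ ⟨x i, mem_tupleAlgebra x i⟩ ∈
      spectrum ℂ (⟨x i, mem_tupleAlgebra x i⟩ : tupleAlgebra x) :=
    AlgHom.apply_mem_spectrum χ _
  rw [StarSubalgebra.spectrum_eq (hS := isClosed_tupleAlgebra x)] at h1
  exact (hsa i).mem_spectrum_eq_re h1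

theorem exists_tupleAlgebra_eq_jointCalculus (hsa : ∀ i, IsSelfAdjoint (x i))
    (hcomm : ∀ i j, Commute (x i) (x j)) (f : (Fin n → ℝ) → ℝ)
    (hf : ContinuousOn f (Set.univ.pi fun i => spectrum ℝ (x i))) :
    ∃ q : tupleAlgebra x, (q : B) = jointCalculus f x hsa hcomm hf ∧
      ∀ χ : characterSpace ℂ (tupleAlgebra x),
        χ q = (f fun i => (χ ⟨x i, mem_tupleAlgebra x i⟩).re : ℝ) := by
  let _ := tupleAlgebraCommCStarAlgebra x hsa hcomm
  refine ⟨_, rfl, fun χ => ?_⟩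
  exact congrArg (fun F : C(characterSpace ℂ (tupleAlgebra x), ℂ) => F χ)
    ((gelfandStarTransform (tupleAlgebra x)).apply_symm_apply _)

end Characters

/-- A complex number in the intersection of suitable disks is nonnegative. -/
theorem Complex.nonneg_of_norm_sub_le {c : ℂ} {M : ℝ} (h1 : ‖c - M‖ ≤ M)
    (h2 : ∀ k : ℤ, ‖c - (k : ℝ) * Complex.I‖ ≤ √(M ^ 2 + (k : ℝ) ^ 2)) : 0 ≤ c := by
  -- Squaring cancels `k²`; large `k` of either sign then forces `c.im = 0`. Integers suffice, so
  -- only countably many disks are used.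
  have h3 : ∀ k : ℤ, -(2 * k * c.im) ≤ M ^ 2 := fun k => by
    have h := pow_le_pow_left₀ (norm_nonneg _) (h2 k) 2
    rw [Real.sq_sqrt (by positivity), ← Complex.normSq_eq_norm_sq, Complex.normSq_apply] at h
    simp only [Complex.sub_re, Complex.mul_re, Complex.ofReal_re, Complex.I_re, Complex.ofReal_im,
      Complex.I_im, Complex.sub_im, Complex.mul_im] at h
    nlinarith [sq_nonneg c.re, sq_nonneg c.im]
  refine Complex.le_def.2 ⟨?_, ?_⟩
  · have := (Complex.abs_re_le_norm _).trans h1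
    rw [Complex.sub_re, Complex.ofReal_re] at this
    simpa using (abs_le.1 this).1
  · by_contra hne
    rw [Complex.zero_im, eq_comm, ← Ne] at hne
    obtain ⟨k, hk⟩ := exists_nat_gt (M ^ 2 / |c.im|)
    rw [div_lt_iff₀ (abs_pos.2 hne)] at hk
    have hk0 : 0 ≤ (k : ℝ) * |c.im| := by positivity
    rcases abs_cases c.im with ⟨h, -⟩ | ⟨h, -⟩
    · have := h3 (-k)
      push_cast at this
      rw [h] at hk hk0
      linarith
    · have := h3 k
      push_cast at this
      rw [h] at hk hk0
      linarith

/-! ### Positivity and affine inequalities. -/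

section Jensen

variable {A : Type*} [NonUnitalCStarAlgebra A] [PartialOrder A] [StarOrderedRing A]
  {C : NonUnitalStarSubalgebra ℂ A} {S : Type*} [TopologicalSpace S] [LocallyCompactSpace S]
  [TopologicalSpace.MetrizableSpace S] [MeasurableSpace S] [BorelSpace S]
  {φ : A →ₚ[ℂ] ℂ} {n : ℕ}

/-- All `χ(y)` lie in `[0, M]` with `M = ‖y‖`, hence in the disk about `M` of radius `M` and those
about `ik` of radius `√(M² + k²)`. Contractivity confines `Φ(y)` to the same disks. -/
theorem ae_conditionalExpectation_nonneg (hCφ : (C : Set A) ⊆ functionalCentralizer φ)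
    (e : C ≃⋆ₐ[ℂ] C₀(S, ℂ)) (x : Fin n → 𝓜(ℂ, A)) (hsa : ∀ i, IsSelfAdjoint (x i))
    (hcomm : ∀ i j, Commute (x i) (x j)) (y : tupleAlgebra x)
    (hy : ∀ χ : characterSpace ℂ (tupleAlgebra x), 0 ≤ χ y) :
    ∀ᵐ s ∂(functionalMeasure φ e), 0 ≤ conditionalExpectation φ e (y : 𝓜(ℂ, A)) s := by
  have hr : ∀ χ : characterSpace ℂ (tupleAlgebra x),
      ∃ r : ℝ, χ y = r ∧ 0 ≤ r ∧ r ≤ ‖(y : 𝓜(ℂ, A))‖ := fun χ => by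
    obtain ⟨h0, h1⟩ := Complex.nonneg_iff.1 (hy χ)
    exact ⟨(χ y).re, Complex.ext rfl h1.symm, h0,
      (Complex.re_le_norm _).trans (norm_character_apply_le x χ y)⟩
  set M := ‖(y : 𝓜(ℂ, A))‖
  have h1 := norm_sub_algebraMap_le_of_character x hsa hcomm y (M : ℂ) (norm_nonneg _)
    (fun χ => by
      obtain ⟨r, hχ, h0, hM⟩ := hr χ
      rw [hχ, ← Complex.ofReal_sub, Complex.norm_real, Real.norm_eq_abs, abs_le]
      constructor <;> linarith)
  have h2 : ∀ k : ℤ, ‖(y : 𝓜(ℂ, A)) - algebraMap ℂ 𝓜(ℂ, A) ((k : ℝ) * Complex.I)‖ ≤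
      √(M ^ 2 + (k : ℝ) ^ 2) := fun k => by
    refine norm_sub_algebraMap_le_of_character x hsa hcomm y _ (Real.sqrt_nonneg _) fun χ => ?_
    obtain ⟨r, hχ, h0, hM⟩ := hr χ
    refine Real.le_sqrt_of_sq_le ?_
    rw [hχ, ← Complex.normSq_eq_norm_sq, Complex.normSq_apply]
    simp only [Complex.sub_re, Complex.mul_re, Complex.ofReal_re, Complex.I_re, Complex.ofReal_im,
      Complex.I_im, Complex.sub_im, Complex.mul_im]
    nlinarith
  filter_upwards [ae_norm_conditionalExpectation_sub_le hCφ e y (M : ℂ),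
    ae_all_iff.2 fun k : ℤ =>
      ae_norm_conditionalExpectation_sub_le hCφ e y (((k : ℝ) : ℂ) * Complex.I)] with s hs1 hs2
  exact Complex.nonneg_of_norm_sub_le (hs1.trans h1) fun k => (hs2 k).trans (h2 k)

/-- The conditional expectation preserves inequalities between `f` and affine functions on the
product of the spectra. -/
theorem ae_affine_conditionalExpectation_nonneg (hCφ : (C : Set A) ⊆ functionalCentralizer φ)
    (e : C ≃⋆ₐ[ℂ] C₀(S, ℂ)) (x : Fin n → 𝓜(ℂ, A)) (hsa : ∀ i, IsSelfAdjoint (x i))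
    (hcomm : ∀ i j, Commute (x i) (x j)) (f : (Fin n → ℝ) → ℝ)
    (hf : ContinuousOn f (Set.univ.pi fun i => spectrum ℝ (x i))) (α : Fin n → ℝ) (β γ : ℝ)
    (h : ∀ p ∈ Set.univ.pi fun i => spectrum ℝ (x i), 0 ≤ ∑ i, α i * p i + β + γ * f p) :
    ∀ᵐ s ∂(functionalMeasure φ e), 0 ≤ ∑ i, (α i : ℂ) * conditionalExpectation φ e (x i) s + β +
      γ * conditionalExpectation φ e (jointCalculus f x hsa hcomm hf) s := by
  obtain ⟨q, hq, hqχ⟩ := exists_tupleAlgebra_eq_jointCalculus x hsa hcomm f hf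
  let y : tupleAlgebra x := ∑ i, (α i : ℂ) • ⟨x i, mem_tupleAlgebra x i⟩ + (β : ℂ) • 1 + (γ : ℂ) • q
  have hy : ∀ χ : characterSpace ℂ (tupleAlgebra x), 0 ≤ χ y := fun χ => by
    have h1 := h (fun i => (χ ⟨x i, mem_tupleAlgebra x i⟩).re)
      fun i _ => character_re_mem_spectrum x hsa χ i
    have h2 : χ y = ((∑ i, α i * (χ ⟨x i, mem_tupleAlgebra x i⟩).re + β +
        γ * f fun i => (χ ⟨x i, mem_tupleAlgebra x i⟩).re : ℝ) : ℂ) := by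
      simp only [y, map_add, map_sum, map_smul, map_one, hqχ, smul_eq_mul, mul_one]
      push_cast
      congr 2
      exact Finset.sum_congr rfl fun i _ => by rw [← character_apply_eq_re x hsa χ i]
    rw [h2]
    exact Complex.zero_le_real.2 h1
  let l : Fin n ⊕ Fin 2 → ℂ := Sum.elim (fun i => (α i : ℂ)) ![(β : ℂ), (γ : ℂ)]
  let X : Fin n ⊕ Fin 2 → 𝓜(ℂ, A) := Sum.elim x ![1, jointCalculus f x hsa hcomm hf]
  have hX : (y : 𝓜(ℂ, A)) = ∑ i, l i • X i := by
    simp [y, l, X, Fintype.sum_sum_type, hq, add_assoc]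
  filter_upwards [ae_conditionalExpectation_nonneg hCφ e x hsa hcomm y hy,
    ae_conditionalExpectation_combination hCφ e l X, ae_conditionalExpectation_one hCφ e]
    with s h1 h2 h3
  rw [hX, h2] at h1
  simpa [l, X, Fintype.sum_sum_type, h3, add_assoc] using h1

end Jensen

/-! ### Jensen's inequality on a compact box. -/

section Jensen

variable {A : Type*} [NonUnitalCStarAlgebra A] [PartialOrder A] [StarOrderedRing A]
  {C : NonUnitalStarSubalgebra ℂ A} {S : Type*} [TopologicalSpace S] [LocallyCompactSpace S]
  [TopologicalSpace.MetrizableSpace S] [MeasurableSpace S] [BorelSpace S]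
  {φ : A →ₚ[ℂ] ℂ} {n : ℕ}

/-- Jensen's inequality for the conditional expectation, on a compact box. -/
theorem ae_jensen_of_Icc (hCφ : (C : Set A) ⊆ functionalCentralizer φ)
    (e : C ≃⋆ₐ[ℂ] C₀(S, ℂ)) (x : Fin n → 𝓜(ℂ, A)) (hsa : ∀ i, IsSelfAdjoint (x i))
    (hcomm : ∀ i j, Commute (x i) (x j)) (f : (Fin n → ℝ) → ℝ)
    (hf : ContinuousOn f (Set.univ.pi fun i => spectrum ℝ (x i))) (a b : Fin n → ℝ)
    (hab : ∀ i, spectrum ℝ (x i) ⊆ Set.Icc (a i) (b i))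
    (hfcont : ContinuousOn f (Set.univ.pi fun i => Set.Icc (a i) (b i)))
    (hfconc : ConcaveOn ℝ (Set.univ.pi fun i => Set.Icc (a i) (b i)) f) :
    ∀ᵐ s ∂(functionalMeasure φ e),
      (∀ i, (conditionalExpectation φ e (x i) s).im = 0 ∧
        (conditionalExpectation φ e (x i) s).re ∈ Set.Icc (a i) (b i)) ∧
      (conditionalExpectation φ e (jointCalculus f x hsa hcomm hf) s).im = 0 ∧
      (conditionalExpectation φ e (jointCalculus f x hsa hcomm hf) s).re ≤
        f fun i => (conditionalExpectation φ e (x i) s).re := by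
  set J : Set (Fin n → ℝ) := Set.univ.pi fun i => Set.Icc (a i) (b i)
  have hJ : IsClosed J := isClosed_set_pi fun i _ => isClosed_Icc
  -- A lower semicontinuous convex function on a closed set is a supremum of countably many affine
  -- functions.
  obtain ⟨l, c, hlc, hsup⟩ := hfconc.neg.real_sSup_of_nat_affine_eq hJ
    hfcont.neg.lowerSemicontinuousOn
  have hl : ∀ k (p : Fin n → ℝ), l k p = ∑ i, l k (Pi.single i 1) * p i := fun k p => by
    conv_lhs => rw [pi_eq_sum_univ' p, map_sum]
    exact Finset.sum_congr rfl fun i _ => by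
      rw [map_smul, smul_eq_mul, mul_comm]
  have hle : ∀ k, ∀ p ∈ J, l k p + c k ≤ -f p := fun k p hp => hlc k ⟨p, hp⟩
  have hsub : ∀ p ∈ Set.univ.pi fun i => spectrum ℝ (x i), p ∈ J :=
    fun p hp i hi => hab i (hp i hi)
  have key := ae_affine_conditionalExpectation_nonneg hCφ e x hsa hcomm f hf
  -- With `γ = 0`, the affine functions `p_i - a_i` and `b_i - p_i` place `Φ(x_i)` in the box.
  have h1 := ae_all_iff.2 fun i => key (Pi.single i 1) (-(a i)) 0 fun p hp => by
    have := (hsub p hp i trivial).1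
    simpa [Pi.single_apply] using this
  have h2 := ae_all_iff.2 fun i => key (Pi.single i (-1)) (b i) 0 fun p hp => by
    have := (hsub p hp i trivial).2
    simpa [Pi.single_apply] using this
  have h3 := ae_all_iff.2 fun k => key (fun i => -l k (Pi.single i 1)) (-c k) (-1) fun p hp => by
    have := hle k p (hsub p hp)
    rw [hl] at this
    simp only [neg_mul, Finset.sum_neg_distrib]
    linarith
  filter_upwards [h1, h2, h3] with s hs1 hs2 hs3
  set P := fun i => conditionalExpectation φ e (x i) s
  set Q := conditionalExpectation φ e (jointCalculus f x hsa hcomm hf) s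
  have hP : ∀ i, (P i).im = 0 ∧ (P i).re ∈ Set.Icc (a i) (b i) := fun i => by
    have e1 := hs1 i
    have e2 := hs2 i
    have E1 : ∑ j, ((Pi.single i (1 : ℝ) : Fin n → ℝ) j : ℂ) * P j = P i := by
      rw [Finset.sum_eq_single i] <;> simp +contextual
    have E2 : ∑ j, ((Pi.single i (-1 : ℝ) : Fin n → ℝ) j : ℂ) * P j = -P i := by
      rw [Finset.sum_eq_single i] <;> simp +contextual
    rw [E1, Complex.nonneg_iff] at e1
    rw [E2, Complex.nonneg_iff] at e2
    simp at e1 e2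
    exact ⟨e1.2.symm, by linarith [e1.1], by linarith [e2.1]⟩
  have hPre : ∀ i, P i = ((P i).re : ℂ) := fun i => Complex.ext rfl (hP i).1
  set p : Fin n → ℝ := fun i => (P i).re
  have hpJ : p ∈ J := fun i _ => (hP i).2
  have hQ : ∀ k, Q.im = 0 ∧ l k p + c k ≤ -Q.re := fun k => by
    have e3 := hs3 k
    have E3 : ∑ i, ((-l k (Pi.single i 1) : ℝ) : ℂ) * P i = ((-l k p : ℝ) : ℂ) := by
      rw [hl k p, ← Finset.sum_neg_distrib]
      push_cast
      exact Finset.sum_congr rfl fun i _ => by rw [hPre i]; ring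
    rw [E3, Complex.nonneg_iff] at e3
    simp at e3
    exact ⟨by linarith [e3.2], by linarith [e3.1]⟩
  -- Any index would show that `Q` is real.
  refine ⟨hP, (hQ 0).1, ?_⟩
  have h4 := congrFun hsup ⟨p, hpJ⟩
  rw [iSup_apply] at h4
  have h5 : ⨆ k, (J.domRestrict (l k) + Function.const J (c k)) ⟨p, hpJ⟩ ≤ -Q.re :=
    ciSup_le fun k => (hQ k).2
  rw [h4] at h5
  exact neg_le_neg_iff.1 h5

end Jensen

/-! ### Reduction of the cube to a compact box. -/

theorem mainTheorem7 {A : Type*} [NonUnitalCStarAlgebra A] [PartialOrder A] [StarOrderedRing A]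
    (C : NonUnitalStarSubalgebra ℂ A) (hCclosed : IsClosed (C : Set A))
    (hCcomm : ∀ y ∈ C, ∀ z ∈ C, y * z = z * y)
    (hCsep : TopologicalSpace.IsSeparable (C : Set A))
    (φ : A →ₚ[ℂ] ℂ) (hCφ : (C : Set A) ⊆ functionalCentralizer φ)
    {S : Type*} [TopologicalSpace S] [LocallyCompactSpace S] [TopologicalSpace.MetrizableSpace S]
    [MeasurableSpace S] [BorelSpace S] (e : C ≃⋆ₐ[ℂ] C₀(S, ℂ)) :
    (∀ (X : 𝓜(ℂ, A)) (g : Lp ℂ ∞ (functionalMeasure φ e)),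
      RepresentsMultiplier φ e X g ↔ g = conditionalExpectation φ e X) ∧
    ∀ (n : ℕ) (I : Fin n → Set ℝ) (_hI : ∀ i, (I i).OrdConnected) (f : (Fin n → ℝ) → ℝ)
      (hfcont : ContinuousOn f (Set.univ.pi I)) (_hfconc : ConcaveOn ℝ (Set.univ.pi I) f)
      (x : Fin n → A) (hsa : ∀ i, IsSelfAdjoint (x i)) (hcomm : ∀ i j, Commute (x i) (x j))
      (hdom : ∀ i, spectrum ℝ (x i : 𝓜(ℂ, A)) ⊆ I i),
      ∀ᵐ s ∂(functionalMeasure φ e),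
        (∀ i, (conditionalExpectation φ e (x i : 𝓜(ℂ, A)) s).im = 0 ∧
          (conditionalExpectation φ e (x i : 𝓜(ℂ, A)) s).re ∈ I i) ∧
        (conditionalExpectation φ e
          (jointCalculus f (fun i => (x i : 𝓜(ℂ, A))) (multiplier_isSelfAdjoint hsa)
            (multiplier_commute hcomm)
            (hfcont.mono (Set.pi_mono fun i _ => hdom i))) s).im = 0 ∧
        (conditionalExpectation φ e
          (jointCalculus f (fun i => (x i : 𝓜(ℂ, A))) (multiplier_isSelfAdjoint hsa)
            (multiplier_commute hcomm)
            (hfcont.mono (Set.pi_mono fun i _ => hdom i))) s).re ≤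
          f fun i => (conditionalExpectation φ e (x i : 𝓜(ℂ, A)) s).re := by
  refine ⟨fun X g => ⟨fun hg => hg.unique (representsMultiplier_conditionalExpectation hCφ e X),
    fun hg => hg ▸ representsMultiplier_conditionalExpectation hCφ e X⟩, ?_⟩
  intro n I hI f hfcont hfconc x hsa hcomm hdom
  -- Spectra are empty if `1 = 0`; then `Φ(1) = 1` has norm at most 0 almost everywhere, so `μ_φ` is
  -- zero.
  rcases subsingleton_or_nontrivial 𝓜(ℂ, A) with hM | hM
  · filter_upwards [ae_conditionalExpectation_one hCφ e,
      ae_norm_conditionalExpectation_le hCφ e (1 : 𝓜(ℂ, A))] with s h1 h2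
    rw [h1, Subsingleton.elim (1 : 𝓜(ℂ, A)) 0, norm_zero, norm_one] at h2
    exact absurd h2 (by norm_num)
  have hsa' := multiplier_isSelfAdjoint hsa
  have hcpt : ∀ i, IsCompact (spectrum ℝ (x i : 𝓜(ℂ, A))) := fun i => spectrum.isCompact _
  have hne : ∀ i, (spectrum ℝ (x i : 𝓜(ℂ, A))).Nonempty := fun i =>
    ContinuousFunctionalCalculus.spectrum_nonempty _ (hsa' i)
  -- The extreme points of the compact spectrum lie in `I i`, and so does the interval between them.
  have hIcc : ∀ i, Set.Icc (sInf (spectrum ℝ (x i : 𝓜(ℂ, A))))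
      (sSup (spectrum ℝ (x i : 𝓜(ℂ, A)))) ⊆ I i := fun i =>
    (hI i).out (hdom i ((hcpt i).sInf_mem (hne i))) (hdom i ((hcpt i).sSup_mem (hne i)))
  have hpi := Set.pi_mono (s := Set.univ) fun i _ => hIcc i
  filter_upwards [ae_jensen_of_Icc hCφ e (fun i => (x i : 𝓜(ℂ, A))) hsa'
    (multiplier_commute hcomm) f (hfcont.mono (Set.pi_mono fun i _ => hdom i)) _ _
    (fun i t ht => ⟨csInf_le (hcpt i).bddBelow ht, le_csSup (hcpt i).bddAbove ht⟩)
    (hfcont.mono hpi) (hfconc.subset hpi (convex_pi fun i _ => convex_Icc _ _))] with s hs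
  exact ⟨fun i => ⟨(hs.1 i).1, hIcc i (hs.1 i).2⟩, hs.2⟩
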